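/- Let $d\ge 1$. For a state $m=(m_1,\dots,m_d)\in\{0,1\}^d$ put $m_+=(m_2,\dots,m_d,1)$ and $m_-=(m_2,\dots,m_d,0)$; the edges $m\to m_\pm$ form the $d$-dimensional binary de Bruijn graph. Two experts are given by functions $q,r:\{0,1\}^d\to(-1,1)$ with $q\neq r$. The investor's linear program is to minimize $M$ over all $M\in\mathbb R$ and $\beta\in\mathbb R^{\{0,1\}^d}$ such that, for every simple cycle $s$ of this graph (with $|s|$ edges, and with $b_{s,m}=\pm1$ if $s$ leaves its vertex $m$ by the edge $m\to m_\pm$), $$\sum_{m\in s}\bigl[(q(m)-r(m))^2-b_{s,m}\beta_m\bigr]\le |s|\,M ;$$ let $C_d^\#$ be its optimal value. For $\varepsilon>0$ and a final-time payoff $\varphi:\mathbb R^2\to\mathbb R$, the scaled game value $u^\varepsilon(t,m,\xi,\eta)$ is defined, for times $t\le T$ such that $(T-t)/\varepsilon^2$ is an integer, by $u^\varepsilon(T,m,\xi,\eta)=\varphi(\xi,\eta)$ and $$u^\varepsilon(t,m,\xi,\eta)=\min_{|f|\le1}\ \max_{b=\pm1}\ u^\varepsilon\bigl(t+\varepsilon^2,\,m_b,\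 \xi+\varepsilon b[q(m)-r(m)],\ \eta+\varepsilon b[q(m)+r(m)-2f]\bigr).$$ **Theorem.** Let $T_0<T$ and let $u(t,\xi,\eta)$ be continuous for $T_0<t\le T$, $(\xi,\eta)\in\mathbb R^2$, and solve $$u_t+\tfrac12\,C_d^\#\Bigl\langle D^2u\,\frac{\nabla^\perp u}{u_\eta},\frac{\nabla^\perp u}{u_\eta}\Bigr\rangle=0\quad(T_0<t<T),\qquad u(T,\xi,\eta)=\varphi(\xi,\eta),$$ where $D^2u$ is the Hessian in $(\xi,\eta)$ and $\nabla^\perp u=(-u_\eta,u_\xi)$. Suppose that, for some constants $K$ and $c>0$, for $T_0<t<T$ and all $(\xi,\eta)$: * $u$ has continuous derivatives in $(\xi,\eta)$ of orders $1$ to $4$, $u_t$ has continuous derivatives in $(\xi,\eta)$ of orders $0$ to $2$, $u_{tt}$ is continuous, and all of these are bounded by $K$ (for the derivatives of order $k$ in space: in the operator norm of $k$-linear forms on $\mathbb R^2$ with the maximum norm); * $u_\eta>c$, $\ |u_\xi|\le u_\eta$, and $u_t\le0$. Then there are a constant $C$, which depends only on $d$, $K$ and $c$, and an $\varepsilon_0>0$,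 which depends only on $d$, $K$, $c$, $q$ and $r$, such that $$u^\varepsilon(t,m,\xi,\eta)\le u(t,\xi,\eta)+C\,[(T-t)+\varepsilon]\,\varepsilon$$ for all $0<\varepsilon\le\varepsilon_0$, all $t$ with $T_0<t<T$ for which $(T-t)/\varepsilon^2$ is an integer, all $m\in\{0,1\}^d$ and all $\xi,\eta\in\mathbb R$. -/

import Mathlib

namespace StockPrediction

/-- The state space `{0,1}^d`: the last `d` stock movements, oldest first
(`true` is an up move, `false` a down move). -/
abbrev State (d : ℕ) : Type := Fin d → Bool

/-- The numerical value `±1` of a stock movement. -/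
def move (b : Bool) : ℝ := if b then 1 else -1

/-- The state that follows `m` when the stock moves by `b` (written `m_+` or `m_-`): the oldest
movement is forgotten and `b` is appended. The edges `m → next m b` form the `d`-dimensional
de Bruijn graph on two symbols. -/
def next {d : ℕ} (m : State d) (b : Bool) : State d :=
  fun i => if h : (i : ℕ) + 1 < d then m ⟨(i : ℕ) + 1, h⟩ else b

/-- `a 0, …, a L` are the successive vertices of a simple cycle with `L ≥ 1` edges in the de Bruijn
graph, whose `i`-th edge leaves `a i` by the movement `b i`: the walk is closed, and there is no
repeated vertex apart from `a L = a 0`. Only the values `a i`, `i ≤ L`, and `b i`, `i < L`, matter. -/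
structure IsSimpleCycle {d : ℕ} (L : ℕ) (a : ℕ → State d) (b : ℕ → Bool) : Prop where
  length_pos : 1 ≤ L
  step : ∀ i < L, a (i + 1) = next (a i) (b i)
  closed : a L = a 0
  simple : ∀ i < L, ∀ j < L, a i = a j → i = j

/-- `(β, M)` is a feasible point of the investor's linear program `A (-β, M)ᵀ ≤ g`, which has one row
for each simple cycle: the row has the entry `±1` in the column of `m` if the cycle leaves `m` by a
`±` edge (and `0` if the cycle avoids `m`), minus the length of the cycle in the last column, and the
corresponding entry of `g` is minus the sum of `(q m - r m)^2` over the vertices of the cycle. -/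
def InvestorFeasible {d : ℕ} (q r : State d → ℝ) (β : State d → ℝ) (M : ℝ) : Prop :=
  ∀ (L : ℕ) (a : ℕ → State d) (b : ℕ → Bool), IsSimpleCycle L a b →
    (∑ i ∈ Finset.range L, move (b i) * (-β (a i))) + (-(L : ℝ)) * M
      ≤ -∑ i ∈ Finset.range L, (q (a i) - r (a i)) ^ 2

/-- The optimal value `C_d^#` of the investor's linear program: the minimum of `M` over all
feasible points. -/
noncomputable def investorLPValue {d : ℕ} (q r : State d → ℝ) : ℝ :=
  sInf {M : ℝ | ∃ β : State d → ℝ, InvestorFeasible q r β M}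

/-- The new position `(ξ, η)` after one step of the scaled game, if the state is `m`, the investor
buys `f` and the stock moves by `b`. -/
def stepPos {d : ℕ} (q r : State d → ℝ) (ε : ℝ) (m : State d) (x : ℝ × ℝ) (f : ℝ) (b : Bool) :
    ℝ × ℝ :=
  (x.1 + ε * move b * (q m - r m), x.2 + ε * move b * (q m + r m - 2 * f))

/-- The value of the scaled game with `n` steps left, by the dynamic programming principle: the
investor minimises over `|f| ≤ 1`, then the market maximises over `b = ±1`. -/
noncomputable def gameValue {d : ℕ} (q r : State d → ℝ) (ε : ℝ) (φ : ℝ × ℝ → ℝ) :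
    ℕ → State d → ℝ × ℝ → ℝ
  | 0, _, x => φ x
  | n + 1, m, x => ⨅ f : Set.Icc (-1 : ℝ) 1,
      max (gameValue q r ε φ n (next m true) (stepPos q r ε m x f true))
        (gameValue q r ε φ n (next m false) (stepPos q r ε m x f false))

/-- The scaled value function `u^ε(t, m, ξ, η)` of the game that ends at time `T` with the payoff
`φ`; it is meant for times `t ≤ T` such that `(T - t) / ε ^ 2` is an integer. -/
noncomputable def scaledValue {d : ℕ} (q r : State d → ℝ) (φ : ℝ × ℝ → ℝ) (T ε t : ℝ)
    (m : State d) (x : ℝ × ℝ) : ℝ :=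
  gameValue q r ε φ ⌊(T - t) / ε ^ 2⌋₊ m x

/-! Functions `u t (ξ, η)` of time and space, and their derivatives. -/

/-- `u_t`. -/
noncomputable def dt (u : ℝ → ℝ × ℝ → ℝ) (t : ℝ) (x : ℝ × ℝ) : ℝ := deriv (fun s => u s x) t

/-- `u_ξ`. -/
noncomputable def dxi (u : ℝ → ℝ × ℝ → ℝ) (t : ℝ) (x : ℝ × ℝ) : ℝ := fderiv ℝ (u t) x (1, 0)

/-- `u_η`. -/
noncomputable def deta (u : ℝ → ℝ × ℝ → ℝ) (t : ℝ) (x : ℝ × ℝ) : ℝ := fderiv ℝ (u t) x (0, 1)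

/-- The quadratic form `⟨D²u v, v⟩` of the spatial Hessian. -/
noncomputable def hess (u : ℝ → ℝ × ℝ → ℝ) (t : ℝ) (x v : ℝ × ℝ) : ℝ :=
  iteratedFDeriv ℝ 2 (u t) x ![v, v]

/-- `∇^⊥u / u_η`, where `∇^⊥u = (-u_η, u_ξ)`. -/
noncomputable def perpDir (u : ℝ → ℝ × ℝ → ℝ) (t : ℝ) (x : ℝ × ℝ) : ℝ × ℝ :=
  (-deta u t x / deta u t x, dxi u t x / deta u t x)

/-- The smoothness assumptions at the times `T₀ < t < T`, with all bounds equal to `K`: `u` has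
continuous, bounded derivatives of order `1` to `4` in space, `u_t` has continuous, bounded
derivatives of order up to `2` in space, and `u_tt` is continuous and bounded. -/
structure SmoothBounded (K T₀ T : ℝ) (u : ℝ → ℝ × ℝ → ℝ) : Prop where
  contDiff_u : ∀ t ∈ Set.Ioo T₀ T, ContDiff ℝ 4 (u t)
  continuous_u : ∀ k : ℕ, 1 ≤ k → k ≤ 4 →
    ContinuousOn (fun p : ℝ × (ℝ × ℝ) => iteratedFDeriv ℝ k (u p.1) p.2)
      (Set.Ioo T₀ T ×ˢ Set.univ)
  bound_u : ∀ k : ℕ, 1 ≤ k → k ≤ 4 → ∀ t ∈ Set.Ioo T₀ T, ∀ x,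
    ‖iteratedFDeriv ℝ k (u t) x‖ ≤ K
  differentiable_u : ∀ t ∈ Set.Ioo T₀ T, ∀ x, DifferentiableAt ℝ (fun s => u s x) t
  contDiff_ut : ∀ t ∈ Set.Ioo T₀ T, ContDiff ℝ 2 (dt u t)
  continuous_ut : ∀ k : ℕ, k ≤ 2 →
    ContinuousOn (fun p : ℝ × (ℝ × ℝ) => iteratedFDeriv ℝ k (dt u p.1) p.2)
      (Set.Ioo T₀ T ×ˢ Set.univ)
  bound_ut : ∀ k : ℕ, k ≤ 2 → ∀ t ∈ Set.Ioo T₀ T, ∀ x, ‖iteratedFDeriv ℝ k (dt u t) x‖ ≤ K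
  differentiable_ut : ∀ t ∈ Set.Ioo T₀ T, ∀ x, DifferentiableAt ℝ (fun s => dt u s x) t
  continuous_utt : ContinuousOn (fun p : ℝ × (ℝ × ℝ) => dt (dt u) p.1 p.2)
    (Set.Ioo T₀ T ×ˢ Set.univ)
  bound_utt : ∀ t ∈ Set.Ioo T₀ T, ∀ x, |dt (dt u) t x| ≤ K

/-- `u` is a solution of `u_t + (1/2) C ⟨D²u ∇^⊥u/u_η, ∇^⊥u/u_η⟩ = 0` at the times `T₀ < t < T`,
and it attains the final-time data `φ` at the time `T` continuously. -/
structure SolvesPDE (C T₀ T : ℝ) (φ : ℝ × ℝ → ℝ) (u : ℝ → ℝ × ℝ → ℝ) : Prop where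
  continuous : ContinuousOn (fun p : ℝ × (ℝ × ℝ) => u p.1 p.2) (Set.Ioc T₀ T ×ˢ Set.univ)
  equation : ∀ t ∈ Set.Ioo T₀ T, ∀ x,
    dt u t x + 1 / 2 * C * hess u t x (perpDir u t x) = 0
  final : ∀ x, u T x = φ x

end StockPrediction

/-! The investor plays an explicit strategy, and the corrected solution `u - ε² κ u_t`, with `κ` a
function of the state, absorbs the dependence on the state. In `exists_investment` the leading part
of `f` makes the position move along the level line of `u`, and a tilt of order `ε` leaves `ε² b B
u_t` as first-order term. The PDE turns the second-order term into `-ε² (q-r)²/C u_t`. Adding the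
time increment and the change of the corrector, one step changes the corrected solution by at most
`-ε² u_t [(q-r)²/C - 1 - b B + κ(m_b) - κ(m)] + O(ε³)`. Since `u_t ≤ 0`, it suffices that the
bracket is nonpositive for both moves.

Such `κ` and `B` come from `exists_potential`. The linear program enters only through the inequality
mean of `(q-r)²` ≤ `C` (`sum_sq_le_investorLPValue`). As the uniform random walk forgets its state
after `d` steps, its Poisson equation is solved by a sum of `d` terms, whose bounds depend only on
`d`.

Summing the errors (`Controlled.gameValue_le`) gives `O((T-t) ε)`; the last step and the removal of
the corrector cost `O(ε²)`. -/

namespace StockPrediction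

/-! ### Cycle decompositions of the de Bruijn graph and a lower bound for the linear program. -/

section Combinatorics

variable {d : ℕ}

lemma abs_move (b : Bool) : |move b| = 1 := by cases b <;> simp [move]

/-- The twisted rotation `m ↦ (m_2, …, m_d, m_1 + s)` of the states. -/
def rotate (hd : 1 ≤ d) (s : Bool) (m : State d) : State d := next m (xor (m ⟨0, hd⟩) s)

lemma rotate_injective (hd : 1 ≤ d) (s : Bool) : Function.Injective (rotate hd s) := by
  intro m m' h
  funext ⟨i, hi⟩
  rcases Nat.eq_zero_or_pos i with rfl | hpos
  · have := congrFun h ⟨d - 1, by omega⟩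
    have hn : ¬ (d - 1 + 1 < d) := by omega
    simpa [rotate, next, hn] using this
  · have := congrFun h ⟨i - 1, by omega⟩
    have hn : i - 1 + 1 = i := by omega
    simpa [rotate, next, hn, hi] using this

lemma sum_rotate (hd : 1 ≤ d) (s : Bool) (F : State d → ℝ) :
    ∑ m, F (rotate hd s m) = ∑ m, F m :=
  (Finite.injective_iff_bijective.mp (rotate_injective hd s)).sum_comp F

lemma add_next_eq_add_rotate (hd : 1 ≤ d) (F : State d → Bool → ℝ) (m : State d) :
    F m true + F m false = F m (xor (m ⟨0, hd⟩) false) + F m (xor (m ⟨0, hd⟩) true) := by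
  cases m ⟨0, hd⟩ <;> simp [add_comm]

/-- A periodic orbit of a twisted rotation is a simple cycle of the de Bruijn graph. -/
lemma isSimpleCycle_rotate (hd : 1 ≤ d) (s : Bool) (m : State d)
    (hm : m ∈ Function.periodicPts (rotate hd s)) :
    IsSimpleCycle (Function.minimalPeriod (rotate hd s) m) (fun i => (rotate hd s)^[i] m)
      (fun i => xor ((rotate hd s)^[i] m ⟨0, hd⟩) s) where
  length_pos := Function.minimalPeriod_pos_of_mem_periodicPts hm
  step i _ := by
    simp only [Function.iterate_succ_apply']
    rfl
  closed := by
    simp only [Function.iterate_zero, id_eq]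
    exact Function.isPeriodicPt_minimalPeriod _ _
  simple i hi j hj h := by
    exact Function.iterate_injOn_Iio_minimalPeriod (Set.mem_Iio.mpr hi) (Set.mem_Iio.mpr hj) h

/-- If the averages of `F` over all periodic orbits of a permutation are at most `M`, then so is the
average of `F` over the whole space. -/
lemma sum_le_of_sum_orbit_le {α : Type*} [Fintype α] {f : α → α} (hf : Function.Injective f)
    (F : α → ℝ) (M : ℝ)
    (h : ∀ x ∈ Function.periodicPts f, ∑ i ∈ Finset.range (Function.minimalPeriod f x), F (f^[i] x)
      ≤ Function.minimalPeriod f x * M) :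
    ∑ x, F x ≤ Fintype.card α * M := by
  classical
  have hb := Finite.injective_iff_bijective.mp hf
  set σ : Equiv.Perm α := Equiv.ofBijective f hb
  -- A common period of all points: over `N` steps every orbit is traversed a whole number of times,
  -- while summing over the starting point as well gives `N` copies of the sum over the space.
  set N := orderOf σ
  have hN : 0 < N := orderOf_pos σ
  have hiter (n : ℕ) : f^[n] = ⇑(σ ^ n) := (Equiv.Perm.iterate_eq_pow σ n)
  have hper (x : α) : Function.IsPeriodicPt f N x := by
    rw [Function.IsPeriodicPt, Function.IsFixedPt, hiter, pow_orderOf_eq_one]; rfl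
  have key (x : α) : ∑ i ∈ Finset.range N, F (f^[i] x) ≤ N * M := by
    obtain ⟨k, hk⟩ := (hper x).minimalPeriod_dvd
    have hx : x ∈ Function.periodicPts f := ⟨N, hN, hper x⟩
    rw [hk]
    clear hk
    induction k with
    | zero => simp
    | succ k ih =>
      rw [mul_add, mul_one, Finset.sum_range_add]
      have hp : ∀ i, f^[Function.minimalPeriod f x * k + i] x = f^[i] x := by
        intro i
        rw [add_comm, Function.iterate_add_apply]
        congr 1
        exact (Function.isPeriodicPt_minimalPeriod f x).mul_const k
      simp only [hp]
      have := h x hx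
      push_cast at ih ⊢
      linarith
  have h1 : ∑ x, ∑ i ∈ Finset.range N, F (f^[i] x) = N * ∑ x, F x := by
    rw [Finset.sum_comm]
    have : ∀ i ∈ Finset.range N, ∑ x, F (f^[i] x) = ∑ x, F x := fun i _ =>
      (hb.iterate i).sum_comp F
    rw [Finset.sum_congr rfl this]
    simp
  have h2 : ∑ x, ∑ i ∈ Finset.range N, F (f^[i] x) ≤ ∑ _x : α, (N * M) :=
    Finset.sum_le_sum fun x _ => key x
  rw [h1] at h2
  simp only [Finset.sum_const, Finset.card_univ, nsmul_eq_mul] at h2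
  have hN' : (0 : ℝ) < N := by exact_mod_cast hN
  nlinarith

/-- Each of the two twisted rotations partitions the states into simple cycles, so the rows of the
program can be averaged over it. The two rotations leave every state by opposite edges, so `β`
cancels when they are added. -/
lemma sum_sq_le_of_feasible (hd : 1 ≤ d) {q r β : State d → ℝ} {M : ℝ}
    (h : InvestorFeasible q r β M) :
    ∑ m, (q m - r m) ^ 2 ≤ 2 ^ d * M := by
  have key (s : Bool) :
      ∑ m : State d, ((q m - r m) ^ 2 - move (xor (m ⟨0, hd⟩) s) * β m) ≤ 2 ^ d * M := by
    have := sum_le_of_sum_orbit_le (rotate_injective hd s)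
      (fun m => (q m - r m) ^ 2 - move (xor (m ⟨0, hd⟩) s) * β m) M ?_
    · simpa using this
    · intro m hm
      have := h _ _ _ (isSimpleCycle_rotate hd s m hm)
      simp only [mul_neg, Finset.sum_neg_distrib] at this
      rw [Finset.sum_sub_distrib]
      linarith
  have h3 := add_le_add (key false) (key true)
  rw [← Finset.sum_add_distrib] at h3
  have h4 : ∀ m : State d, ((q m - r m) ^ 2 - move (xor (m ⟨0, hd⟩) false) * β m) +
      ((q m - r m) ^ 2 - move (xor (m ⟨0, hd⟩) true) * β m) = 2 * (q m - r m) ^ 2 := by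
    intro m
    cases m ⟨0, hd⟩ <;> simp [move] <;> ring
  simp only [h4, ← Finset.mul_sum] at h3
  linarith

/-- A feasible point is needed because the infimum of an empty set of reals is `0` by convention. -/
lemma investorFeasible_zero (q r : State d → ℝ) :
    InvestorFeasible q r 0 (∑ m, (q m - r m) ^ 2) := by
  intro L a b _
  have : ∑ i ∈ Finset.range L, (q (a i) - r (a i)) ^ 2
      ≤ ∑ _i ∈ Finset.range L, ∑ m, (q m - r m) ^ 2 :=
    Finset.sum_le_sum fun i _ =>
      Finset.single_le_sum (f := fun m => (q m - r m) ^ 2) (fun _ _ => sq_nonneg _)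
        (Finset.mem_univ (a i))
  simp only [Finset.sum_const, Finset.card_range, nsmul_eq_mul] at this
  simp only [Pi.zero_apply, neg_zero, mul_zero, Finset.sum_const_zero]
  linarith

lemma sum_sq_le_investorLPValue (hd : 1 ≤ d) (q r : State d → ℝ) :
    ∑ m, (q m - r m) ^ 2 ≤ 2 ^ d * investorLPValue q r := by
  have : (∑ m, (q m - r m) ^ 2) / 2 ^ d ≤ investorLPValue q r := by
    refine le_csInf ⟨_, 0, investorFeasible_zero q r⟩ ?_
    rintro M ⟨β, hβ⟩
    rw [div_le_iff₀' (by positivity)]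
    exact sum_sq_le_of_feasible hd hβ
  rwa [div_le_iff₀' (by positivity)] at this

lemma investorLPValue_pos (hd : 1 ≤ d) {q r : State d → ℝ} (h : ∃ m, q m ≠ r m) :
    0 < investorLPValue q r := by
  obtain ⟨m, hm⟩ := h
  have h1 : 0 < ∑ m, (q m - r m) ^ 2 :=
    Finset.sum_pos' (fun _ _ => sq_nonneg _) ⟨m, Finset.mem_univ _, by
      have := sub_ne_zero.mpr hm
      positivity⟩
  have := h1.trans_le (sum_sq_le_investorLPValue hd q r)
  exact (pos_iff_pos_of_mul_pos this).mp (by positivity)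

/-! ### The Poisson equation of the uniform random walk. -/

/-- The transition operator of the uniform random walk on the de Bruijn graph. -/
noncomputable def average (F : State d → ℝ) (m : State d) : ℝ :=
  (F (next m true) + F (next m false)) / 2

/-- The operator is the mean of two permutations, the twisted rotations, so the uniform measure is
invariant. -/
lemma sum_average (hd : 1 ≤ d) (F : State d → ℝ) : ∑ m, average F m = ∑ m, F m := by
  have h (m : State d) : average F m = (F (rotate hd false m) + F (rotate hd true m)) / 2 := by
    unfold average rotate
    rw [add_next_eq_add_rotate hd (fun m b => F (next m b))]
  simp only [h, ← Finset.sum_div, Finset.sum_add_distrib, sum_rotate]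
  ring

lemma sum_iterate_average (hd : 1 ≤ d) (F : State d → ℝ) (k : ℕ) :
    ∑ m, average^[k] F m = ∑ m, F m := by
  induction k with
  | zero => rfl
  | succ k ih => rw [Function.iterate_succ_apply', sum_average hd, ih]

/-- After `k` steps of the random walk, the first `k` movements are forgotten. -/
lemma iterate_average_congr (F : State d → ℝ) (k : ℕ) :
    ∀ m m' : State d, (∀ i : Fin d, k ≤ i → m i = m' i) → average^[k] F m = average^[k] F m' := by
  induction k with
  | zero => intro m m' h; rw [funext fun i => h i (Nat.zero_le _)]
  | succ k ih =>
    intro m m' h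
    have key (b : Bool) : average^[k] F (next m b) = average^[k] F (next m' b) := by
      refine ih _ _ fun i hi => ?_
      unfold next
      split_ifs with h'
      · exact h _ (by simpa using hi)
      · rfl
    rw [Function.iterate_succ_apply']
    simp only [average, key]

lemma iterate_average_eq_mean (hd : 1 ≤ d) (F : State d → ℝ) (m : State d) :
    2 ^ d * average^[d] F m = ∑ m, F m := by
  rw [← sum_iterate_average hd F d,
    Finset.sum_congr rfl fun m' _ => iterate_average_congr F d m' m fun i hi => by omega]
  simp

lemma iterate_average_mem_Icc {F : State d → ℝ} {a : ℝ} (h : ∀ m, F m ∈ Set.Icc 0 a) (k : ℕ) :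
    ∀ m, average^[k] F m ∈ Set.Icc 0 a := by
  induction k with
  | zero => exact h
  | succ k ih =>
    intro m
    rw [Function.iterate_succ_apply']
    obtain ⟨h1, h2⟩ := ih (next m true)
    obtain ⟨h3, h4⟩ := ih (next m false)
    constructor <;> simp only [average] <;> linarith

/-- Existence of a potential `κ` with bounds that depend only on `d`. -/
lemma exists_potential (hd : 1 ≤ d) {q r : State d → ℝ} (h : ∃ m, q m ≠ r m) :
    ∃ κ B : State d → ℝ, (∀ m, |κ m| ≤ d * 2 ^ d) ∧ (∀ m, |B m| ≤ d * 2 ^ d) ∧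
      (∀ m, (q m - r m) ^ 2 / investorLPValue q r ≤ d * 2 ^ d) ∧
      ∀ m b, (q m - r m) ^ 2 / investorLPValue q r - 1 - move b * B m + κ (next m b) - κ m ≤ 0 := by
  have hC := investorLPValue_pos hd h
  have hsum := sum_sq_le_investorLPValue hd q r
  set C := investorLPValue q r
  set ψ : State d → ℝ := fun m => (q m - r m) ^ 2 / C with hψ
  -- One summand is at most the whole sum, which is at most `2 ^ d * C`; this makes all later bounds
  -- independent of `q` and `r`.
  have hψ_mem (m : State d) : ψ m ∈ Set.Icc (0 : ℝ) (2 ^ d) := by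
    refine ⟨by positivity, ?_⟩
    rw [hψ, div_le_iff₀ hC]
    exact (Finset.single_le_sum (f := fun m => (q m - r m) ^ 2) (fun _ _ => sq_nonneg _)
        (Finset.mem_univ m)).trans hsum
  -- The Green series, stopped at `d`: `average κ - κ` telescopes to `average^[d] ψ - ψ`, and
  -- `average^[d] ψ` is the constant mean of `ψ`, which is at most `1`.
  set κ : State d → ℝ := fun m => ∑ k ∈ Finset.range d, average^[k] ψ m with hκ
  have hκ_mem (m : State d) : κ m ∈ Set.Icc (0 : ℝ) (d * 2 ^ d) := by
    refine ⟨Finset.sum_nonneg fun k _ => (iterate_average_mem_Icc hψ_mem k m).1, ?_⟩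
    calc κ m ≤ ∑ _k ∈ Finset.range d, (2 : ℝ) ^ d :=
          Finset.sum_le_sum fun k _ => (iterate_average_mem_Icc hψ_mem k m).2
      _ = d * 2 ^ d := by simp
  have hd' : (1 : ℝ) ≤ d := by exact_mod_cast hd
  have hpois (m : State d) : ψ m - 1 + average κ m - κ m ≤ 0 := by
    have h1 : average κ m = ∑ k ∈ Finset.range d, average^[k + 1] ψ m := by
      simp only [Function.iterate_succ_apply', average, hκ, ← Finset.sum_div,
        Finset.sum_add_distrib]
    have h2 : average κ m - κ m = average^[d] ψ m - ψ m := by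
      rw [h1, hκ, ← Finset.sum_sub_distrib,
        Finset.sum_range_sub (fun k => average^[k] ψ m) d]
      rfl
    have h3 : 2 ^ d * average^[d] ψ m ≤ 2 ^ d * 1 := by
      rw [iterate_average_eq_mean hd, hψ, ← Finset.sum_div, div_le_iff₀ hC]
      linarith
    have := le_of_mul_le_mul_left h3 (by positivity)
    linarith
  -- With this `B`, `κ (next m b) - move b * B m` equals `average κ m` for both `b`, so both
  -- inequalities reduce to `hpois`.
  refine ⟨κ, fun m => (κ (next m true) - κ (next m false)) / 2, fun m => ?_, fun m => ?_,
    fun m => ?_, fun m b => ?_⟩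
  · rw [abs_of_nonneg (hκ_mem m).1]; exact (hκ_mem m).2
  · obtain ⟨h1, h2⟩ := hκ_mem (next m true)
    obtain ⟨h3, h4⟩ := hκ_mem (next m false)
    rw [abs_le]; constructor <;> linarith
  · refine (hψ_mem m).2.trans ?_
    nlinarith [show (0 : ℝ) < 2 ^ d by positivity]
  · have := hpois m
    simp only [average, hψ] at this
    cases b <;> simp only [move, if_true, Bool.false_eq_true, if_false] <;> linarith

end Combinatorics

end StockPrediction
namespace StockPrediction

/-! ### Taylor expansion and bilinear estimates. -/

section Analysis

/-- Second order Taylor expansion with a bound for the third derivative. -/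
lemma taylor_two_le {E : Type*} [NormedAddCommGroup E] [NormedSpace ℝ E] {f : E → ℝ} {K : ℝ}
    (hf : ContDiff ℝ 3 f) (hK : ∀ x, ‖iteratedFDeriv ℝ 3 f x‖ ≤ K) (x v : E) :
    f (x + v) ≤ f x + fderiv ℝ f x v + 1 / 2 * iteratedFDeriv ℝ 2 f x ![v, v]
      + 1 / 2 * K * ‖v‖ ^ 3 := by
  have hK0 : 0 ≤ K := (norm_nonneg _).trans (hK x)
  have hline (s : ℝ) : HasDerivAt (fun s : ℝ => x + s • v) v s := by
    simpa using ((hasDerivAt_id s).smul_const v).const_add x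
  have hf1 : Differentiable ℝ f := hf.differentiable (by norm_num)
  have hf2 : ContDiff ℝ 2 (fderiv ℝ f) := hf.fderiv_right (by norm_num)
  have hd1 : deriv (fun s : ℝ => f (x + s • v)) = fun s => fderiv ℝ f (x + s • v) v := by
    funext s
    exact ((hf1 _).hasFDerivAt.comp_hasDerivAt s (hline s)).deriv
  have hd2 : deriv (fun s : ℝ => fderiv ℝ f (x + s • v) v) =
      fun s => iteratedFDeriv ℝ 2 f (x + s • v) ![v, v] := by
    funext s
    have h := (((hf2.differentiable (by norm_num)) _).hasFDerivAt.comp_hasDerivAt s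
      (hline s)).clm_apply (hasDerivAt_const s v)
    rw [iteratedFDeriv_two_apply]
    simpa using h.deriv
  have hlip (y : E) : |iteratedFDeriv ℝ 2 f y ![v, v] - iteratedFDeriv ℝ 2 f x ![v, v]|
      ≤ K * ‖y - x‖ * ‖v‖ ^ 2 := by
    have h1 : ‖iteratedFDeriv ℝ 2 f y - iteratedFDeriv ℝ 2 f x‖ ≤ K * ‖y - x‖ := by
      refine convex_univ.norm_image_sub_le_of_norm_fderiv_le (𝕜 := ℝ) (fun z _ => ?_)
        (fun z _ => ?_) (Set.mem_univ x) (Set.mem_univ y)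
      · exact (hf.differentiable_iteratedFDeriv (m := 2) (by norm_num)) z
      · rw [norm_fderiv_iteratedFDeriv]; exact hK z
    have h2 := (iteratedFDeriv ℝ 2 f y - iteratedFDeriv ℝ 2 f x).le_opNorm ![v, v]
    rw [Fin.prod_univ_two] at h2
    simp only [sub_apply, Matrix.cons_val_zero, Matrix.cons_val_one, Real.norm_eq_abs] at h2
    refine h2.trans ?_
    rw [← sq]
    gcongr
  have hc : ContDiff ℝ 3 (fun s : ℝ => f (x + s • v)) :=
    hf.comp (contDiff_const.add (contDiff_id.smul contDiff_const))
  -- The remainder is the Hessian at an intermediate point, moved back to `x` by its Lipschitz bound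
  -- `hlip`; hence the constant `1/2` instead of the sharp `1/6`.
  obtain ⟨s, hs, hs'⟩ := taylor_mean_remainder_lagrange_iteratedDeriv (n := 1)
    (f := fun s : ℝ => f (x + s • v)) (x₀ := 0) (x := 1) (by norm_num)
    (hc.contDiffOn.of_le (by norm_num))
  have hder0 : derivWithin (fun s : ℝ => f (x + s • v)) (Set.Icc 0 1) 0 = fderiv ℝ f x v := by
    rw [((hc.differentiable (by norm_num)) 0).derivWithin
      (uniqueDiffOn_Icc_zero_one 0 (by simp)), hd1]
    simp
  have hit : iteratedDeriv 2 (fun s : ℝ => f (x + s • v)) s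
      = iteratedFDeriv ℝ 2 f (x + s • v) ![v, v] := by
    rw [iteratedDeriv_succ, iteratedDeriv_one, hd1, hd2]
  simp [taylorWithinEval_succ, iteratedDerivWithin_one, hder0, hit] at hs'
  have hs2 := (abs_le.mp (hlip (x + s • v))).2
  have hsn : ‖x + s • v - x‖ ≤ ‖v‖ := by
    rw [add_sub_cancel_left, norm_smul, Real.norm_eq_abs, abs_of_pos (by simpa using hs.1)]
    have := hs.2
    simp at this
    nlinarith [norm_nonneg v]
  have : K * ‖x + s • v - x‖ * ‖v‖ ^ 2 ≤ K * ‖v‖ ^ 3 := by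
    calc K * ‖x + s • v - x‖ * ‖v‖ ^ 2 ≤ K * ‖v‖ * ‖v‖ ^ 2 := by gcongr
      _ = K * ‖v‖ ^ 3 := by ring
  linarith

/-- A bounded bilinear form on the diagonal is locally Lipschitz. -/
lemma diag_le_add {E : Type*} [NormedAddCommGroup E] [NormedSpace ℝ E]
    (A : ContinuousMultilinearMap ℝ (fun _ : Fin 2 => E) ℝ) {K R δ : ℝ} (hA : ‖A‖ ≤ K)
    {v w : E} (hv : ‖v‖ ≤ R) (hw : ‖w‖ ≤ R) (hvw : ‖w - v‖ ≤ δ) :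
    A ![w, w] ≤ A ![v, v] + 2 * K * δ * R := by
  have hK : 0 ≤ K := (norm_nonneg _).trans hA
  have hR : 0 ≤ R := (norm_nonneg _).trans hv
  have hδ : 0 ≤ δ := (norm_nonneg _).trans hvw
  have h1 : A ![w, w] = A ![v, w] + A ![w - v, w] := by
    have := A.cons_add ![w] v (w - v)
    simpa using this
  have h2 : A ![v, w] = A ![v, v] + A ![v, w - v] := by
    have hu (x : E) : Function.update ![v, v] 1 x = ![v, x] := by
      ext i; fin_cases i <;> rfl
    have := A.map_update_add ![v, v] 1 v (w - v)
    rwa [hu, hu, hu, add_sub_cancel] at this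
  have bd (a b : E) {α γ : ℝ} (ha : ‖a‖ ≤ α) (hb : ‖b‖ ≤ γ) : A ![a, b] ≤ K * (α * γ) := by
    have h := A.le_opNorm ![a, b]
    rw [Fin.prod_univ_two] at h
    simp only [Matrix.cons_val_zero, Matrix.cons_val_one] at h
    have hα : 0 ≤ α := (norm_nonneg _).trans ha
    refine (le_abs_self _).trans (h.trans ?_)
    gcongr
  have h3 := bd (w - v) w hvw hw
  have h4 := bd v (w - v) hv hvw
  rw [h1, h2]
  linarith

end Analysis

end StockPrediction
namespace StockPrediction

/-! ### Lipschitz and Taylor bounds for `u` and `u_t`. -/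

section Regularity

variable {K T₀ T : ℝ} {u : ℝ → ℝ × ℝ → ℝ}

lemma SmoothBounded.abs_dt_le (h : SmoothBounded K T₀ T u) {t : ℝ} (ht : t ∈ Set.Ioo T₀ T)
    (x : ℝ × ℝ) : |dt u t x| ≤ K := by
  have := h.bound_ut 0 (by norm_num) t ht x
  rwa [norm_iteratedFDeriv_zero] at this

lemma SmoothBounded.nonneg (h : SmoothBounded K T₀ T u) {t : ℝ} (ht : t ∈ Set.Ioo T₀ T) :
    0 ≤ K :=
  (abs_nonneg _).trans (h.abs_dt_le ht 0)

lemma SmoothBounded.abs_sub_le (h : SmoothBounded K T₀ T u) {t : ℝ} (ht : t ∈ Set.Ioo T₀ T)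
    (x y : ℝ × ℝ) : |u t y - u t x| ≤ K * ‖y - x‖ := by
  refine convex_univ.norm_image_sub_le_of_norm_fderiv_le (𝕜 := ℝ) (f := u t) (fun z _ => ?_)
    (fun z _ => ?_) (Set.mem_univ x) (Set.mem_univ y)
  · exact (h.contDiff_u t ht).differentiable (by norm_num) z
  · rw [← norm_iteratedFDeriv_one]
    exact h.bound_u 1 le_rfl (by norm_num) t ht z

lemma SmoothBounded.abs_dt_sub_le (h : SmoothBounded K T₀ T u) {t : ℝ} (ht : t ∈ Set.Ioo T₀ T)
    (x y : ℝ × ℝ) : |dt u t y - dt u t x| ≤ K * ‖y - x‖ := by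
  refine convex_univ.norm_image_sub_le_of_norm_fderiv_le (𝕜 := ℝ) (f := dt u t) (fun z _ => ?_)
    (fun z _ => ?_) (Set.mem_univ x) (Set.mem_univ y)
  · exact (h.contDiff_ut t ht).differentiable (by norm_num) z
  · rw [← norm_iteratedFDeriv_one]
    exact h.bound_ut 1 (by norm_num) t ht z

lemma SmoothBounded.abs_dt_sub_time_le (h : SmoothBounded K T₀ T u) {t t' : ℝ} (ht : T₀ < t)
    (htt' : t < t') (ht' : t' < T) (x : ℝ × ℝ) : |dt u t' x - dt u t x| ≤ K * (t' - t) := by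
  have hd (s : ℝ) (hs : s ∈ Set.Icc t t') : DifferentiableAt ℝ (fun s => dt u s x) s :=
    h.differentiable_ut s ⟨ht.trans_le hs.1, hs.2.trans_lt ht'⟩ x
  obtain ⟨s, hs, hs'⟩ := exists_deriv_eq_slope (fun s => dt u s x) htt'
    (fun s hs => (hd s hs).continuousAt.continuousWithinAt)
    (fun s hs => (hd s (Set.Ioo_subset_Icc_self hs)).differentiableWithinAt)
  have hb := h.bound_utt s ⟨ht.trans hs.1, hs.2.trans ht'⟩ x
  have hpos : 0 < t' - t := sub_pos.mpr htt'
  rw [dt, hs', abs_div, abs_of_pos hpos, div_le_iff₀ hpos] at hb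
  exact hb

lemma SmoothBounded.exists_dt_eq_slope (h : SmoothBounded K T₀ T u)
    (hc : ContinuousOn (fun p : ℝ × (ℝ × ℝ) => u p.1 p.2) (Set.Ioc T₀ T ×ˢ Set.univ))
    {t t' : ℝ} (ht : T₀ < t) (htt' : t < t') (ht' : t' ≤ T) (x : ℝ × ℝ) :
    ∃ s ∈ Set.Ioo t t', u t' x - u t x = dt u s x * (t' - t) := by
  have hpos : 0 < t' - t := sub_pos.mpr htt'
  obtain ⟨s, hs, hs'⟩ := exists_deriv_eq_slope (fun s => u s x) htt'
    (hc.comp (f := fun s : ℝ => (s, x)) (by fun_prop)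
      (fun s hs => ⟨⟨ht.trans_le hs.1, hs.2.trans ht'⟩, Set.mem_univ _⟩))
    (fun s hs => (h.differentiable_u s
      ⟨ht.trans hs.1, hs.2.trans_le ht'⟩ x).differentiableWithinAt)
  refine ⟨s, hs, ?_⟩
  rw [dt, hs', div_mul_cancel₀ _ hpos.ne']

lemma SmoothBounded.abs_sub_time_le (h : SmoothBounded K T₀ T u)
    (hc : ContinuousOn (fun p : ℝ × (ℝ × ℝ) => u p.1 p.2) (Set.Ioc T₀ T ×ˢ Set.univ))
    {t t' : ℝ} (ht : T₀ < t) (htt' : t < t') (ht' : t' ≤ T) (x : ℝ × ℝ) :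
    |u t' x - u t x| ≤ K * (t' - t) := by
  obtain ⟨s, hs, hs'⟩ := h.exists_dt_eq_slope hc ht htt' ht' x
  rw [hs', abs_mul, abs_of_pos (sub_pos.mpr htt')]
  have := h.abs_dt_le ⟨ht.trans hs.1, hs.2.trans_le ht'⟩ x
  have := sub_pos.mpr htt'
  gcongr

lemma SmoothBounded.le_add_dt (h : SmoothBounded K T₀ T u)
    (hc : ContinuousOn (fun p : ℝ × (ℝ × ℝ) => u p.1 p.2) (Set.Ioc T₀ T ×ˢ Set.univ))
    {t t' : ℝ} (ht : T₀ < t) (htt' : t < t') (ht' : t' ≤ T) (x : ℝ × ℝ) :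
    u t' x ≤ u t x + (t' - t) * dt u t x + K * (t' - t) ^ 2 := by
  obtain ⟨s, hs, hs'⟩ := h.exists_dt_eq_slope hc ht htt' ht' x
  have hpos := sub_pos.mpr htt'
  have h1 := (abs_le.mp (h.abs_dt_sub_time_le ht hs.1 (hs.2.trans_le ht') x)).2
  have hK := h.nonneg (t := t) ⟨ht, htt'.trans_le ht'⟩
  have h2 : dt u s x ≤ dt u t x + K * (t' - t) := by
    have := mul_le_mul_of_nonneg_left (sub_le_sub_right hs.2.le t) hK
    linarith
  have := mul_le_mul_of_nonneg_right h2 hpos.le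
  nlinarith

end Regularity

/-! ### The investor's strategy. -/

section Investment

lemma norm_prod_le_iff {a b R : ℝ} : ‖((a, b) : ℝ × ℝ)‖ ≤ R ↔ |a| ≤ R ∧ |b| ≤ R := by
  simp [Prod.norm_def]

/-- The investment that cancels the first order term of the increment of `v` up to a prescribed
second order correction `B * a`. -/
lemma exists_investment {v : ℝ × ℝ → ℝ} {K c C D a B q r δ ε : ℝ} (hv : ContDiff ℝ 3 v)
    (h2 : ∀ x, ‖iteratedFDeriv ℝ 2 v x‖ ≤ K) (h3 : ∀ x, ‖iteratedFDeriv ℝ 3 v x‖ ≤ K)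
    (hc : 0 < c) (hC : 0 < C) (x : ℝ × ℝ) (hη : c < fderiv ℝ v x (0, 1))
    (hξ : |fderiv ℝ v x (1, 0)| ≤ fderiv ℝ v x (0, 1))
    (ha : |a| ≤ K) (hB : |B| ≤ D)
    (heq : a + 1 / 2 * C * iteratedFDeriv ℝ 2 v x
      ![(-1, fderiv ℝ v x (1, 0) / fderiv ℝ v x (0, 1)),
        (-1, fderiv ℝ v x (1, 0) / fderiv ℝ v x (0, 1))] = 0)
    (hδ : 0 ≤ δ) (hq : |q| ≤ 1 - δ) (hr : |r| ≤ 1 - δ) (hε : 0 < ε) (hε1 : ε ≤ 1)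
    (hεδ : ε * (D * K / c) ≤ 2 * δ) :
    ∃ f ∈ Set.Icc (-1 : ℝ) 1, ∀ σ : ℝ, |σ| = 1 →
      ‖((ε * σ * (q - r), ε * σ * (q + r - 2 * f)) : ℝ × ℝ)‖ ≤ ε * (2 + D * K / c) ∧
      v (x + (ε * σ * (q - r), ε * σ * (q + r - 2 * f))) ≤
        v x + ε ^ 2 * (σ * B * a - (q - r) ^ 2 / C * a)
          + (K * (D * K / c) * (2 + D * K / c) + K * (2 + D * K / c) ^ 3) * ε ^ 3 := by
  have hK : 0 ≤ K := (abs_nonneg _).trans ha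
  have hD : 0 ≤ D := (abs_nonneg _).trans hB
  set vξ := fderiv ℝ v x (1, 0)
  set vη := fderiv ℝ v x (0, 1)
  have hη0 : 0 < vη := hc.trans hη
  set ρ := vξ / vη with hρ
  have hρ1 : |ρ| ≤ 1 := by
    rw [hρ, abs_div, abs_of_pos hη0, div_le_one hη0]; exact hξ
  set Z := D * K / c
  have hZ : 0 ≤ Z := by positivity
  set z := -(B * a / vη) with hz
  have hzZ : |z| ≤ Z := by
    rw [hz, abs_neg, abs_div, abs_mul, abs_of_pos hη0]
    have : |B| * |a| ≤ D * K := by gcongr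
    exact div_le_div₀ (by positivity) this hc hη.le
  set R := 2 + Z
  obtain ⟨hq1, hq2⟩ := abs_le.mp hq
  obtain ⟨hr1, hr2⟩ := abs_le.mp hr
  obtain ⟨hρ2, hρ3⟩ := abs_le.mp hρ1
  obtain ⟨hz1, hz2⟩ := abs_le.mp hzZ
  have hg : |q - r| ≤ 2 := by rw [abs_le]; constructor <;> linarith
  have hgρ : |(q - r) * ρ| ≤ 2 := by
    rw [abs_mul]; nlinarith [abs_nonneg (q - r), abs_nonneg ρ]
  -- As `|ρ| ≤ 1`, this is a combination of `q` and `r` with nonnegative weights of sum `2`. The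
  -- remaining room `2 * δ` accommodates the tilt `ε * z`.
  have hsum : |q + r + (q - r) * ρ| ≤ 2 * (1 - δ) := by
    have : q + r + (q - r) * ρ = q * (1 + ρ) + r * (1 - ρ) := by ring
    rw [this, abs_le]
    constructor <;> nlinarith
  have hεz : |ε * z| ≤ ε * Z := by rw [abs_mul, abs_of_pos hε]; gcongr
  have hεz' : |ε * z| ≤ Z := hεz.trans (by nlinarith)
  -- The part with `ρ` makes the increment orthogonal to the gradient; `z` is chosen so that the
  -- tilt contributes exactly `ε ^ 2 * (σ * B * a)`.
  refine ⟨(q + r + (q - r) * ρ + ε * z) / 2, ?_, fun σ hσ => ?_⟩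
  · have := abs_le.mp hsum
    have := abs_le.mp hεz
    constructor <;> linarith
  have hσ2 : σ ^ 2 = 1 := by rw [← sq_abs, hσ, one_pow]
  set w : ℝ × ℝ := (q - r, -((q - r) * ρ) - ε * z) with hw
  set w₀ : ℝ × ℝ := (q - r, -((q - r) * ρ)) with hw₀
  have hstep : ((ε * σ * (q - r), ε * σ * (q + r - 2 * ((q + r + (q - r) * ρ + ε * z) / 2))) :
      ℝ × ℝ) = (ε * σ) • w := by
    rw [hw, Prod.smul_mk, smul_eq_mul, smul_eq_mul]
    congr 1
    ring
  have hwR : ‖w‖ ≤ R := by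
    rw [hw, norm_prod_le_iff]
    refine ⟨by linarith, (abs_sub _ _).trans ?_⟩
    rw [abs_neg]
    linarith
  have hw₀R : ‖w₀‖ ≤ R := by
    rw [hw₀, norm_prod_le_iff, abs_neg]
    constructor <;> linarith
  have hww₀ : ‖w - w₀‖ ≤ ε * Z := by
    have : w - w₀ = (0, -(ε * z)) := by
      rw [hw, hw₀, Prod.mk_sub_mk]; congr 1 <;> ring
    rw [this, norm_prod_le_iff, abs_neg, abs_zero]
    exact ⟨by positivity, hεz⟩
  have hnorm : ‖(ε * σ) • w‖ ≤ ε * R := by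
    rw [norm_smul, Real.norm_eq_abs, abs_mul, hσ, abs_of_pos hε, mul_one]
    gcongr
  rw [hstep]
  refine ⟨hnorm, ?_⟩
  have ht := taylor_two_le hv h3 x ((ε * σ) • w)
  have hlin : fderiv ℝ v x ((ε * σ) • w) = ε ^ 2 * (σ * B * a) := by
    have h1 : w = (q - r) • ((1, 0) : ℝ × ℝ) + (-((q - r) * ρ) - ε * z) • ((0, 1) : ℝ × ℝ) := by
      simp [hw]
    rw [map_smul, h1, map_add, map_smul, map_smul]
    simp only [smul_eq_mul]
    change ε * σ * ((q - r) * vξ + (-((q - r) * ρ) - ε * z) * vη) = _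
    rw [hρ, hz]
    field_simp
    ring
  have hquad : iteratedFDeriv ℝ 2 v x ![(ε * σ) • w, (ε * σ) • w]
      = ε ^ 2 * iteratedFDeriv ℝ 2 v x ![w, w] := by
    have := (iteratedFDeriv ℝ 2 v x).map_smul_univ (fun _ => ε * σ) ![w, w]
    simp only [Fin.prod_univ_two, smul_eq_mul] at this
    rw [show ε ^ 2 = ε * σ * (ε * σ) by linear_combination -ε ^ 2 * hσ2, ← this]
    congr 1
    funext i; fin_cases i <;> rfl
  have hquad₀ : iteratedFDeriv ℝ 2 v x ![w₀, w₀]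
      = (q - r) ^ 2 * iteratedFDeriv ℝ 2 v x ![(-1, ρ), (-1, ρ)] := by
    have h1 : w₀ = (-(q - r)) • ((-1, ρ) : ℝ × ℝ) := by
      rw [hw₀, Prod.smul_mk, smul_eq_mul, smul_eq_mul]; congr 1 <;> ring
    have := (iteratedFDeriv ℝ 2 v x).map_smul_univ (fun _ => -(q - r))
      ![((-1, ρ) : ℝ × ℝ), (-1, ρ)]
    simp only [Fin.prod_univ_two, smul_eq_mul] at this
    rw [show (q - r) ^ 2 = -(q - r) * -(q - r) by ring, ← this, h1]
    congr 1
    funext i; fin_cases i <;> rfl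
  have hdiag := diag_le_add (iteratedFDeriv ℝ 2 v x) (h2 x) hw₀R hwR hww₀
  have hH : (q - r) ^ 2 * iteratedFDeriv ℝ 2 v x ![(-1, ρ), (-1, ρ)]
      = -2 * ((q - r) ^ 2 / C * a) := by
    field_simp
    linear_combination 2 * (q - r) ^ 2 * heq
  rw [hquad₀, hH] at hdiag
  have hcub : K * ‖(ε * σ) • w‖ ^ 3 ≤ K * (ε * R) ^ 3 := by gcongr
  have hcub' : 0 ≤ K * (ε * R) ^ 3 := by positivity
  rw [hlin, hquad] at ht
  have hdiag' := mul_le_mul_of_nonneg_left hdiag (sq_nonneg ε)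
  have hR3 : K * (ε * R) ^ 3 = K * R ^ 3 * ε ^ 3 := by ring
  linarith

end Investment

/-! ### Linear lower bounds and the dynamic programming inequality. -/

section Game

variable {d : ℕ} {q r : State d → ℝ} {ε : ℝ} {φ : ℝ × ℝ → ℝ}

lemma norm_stepPos_le (hq : ∀ m, |q m| < 1) (hr : ∀ m, |r m| < 1) (hε : 0 ≤ ε) (m : State d)
    (x : ℝ × ℝ) {f : ℝ} (hf : f ∈ Set.Icc (-1 : ℝ) 1) (b : Bool) :
    ‖stepPos q r ε m x f b‖ ≤ ‖x‖ + 4 * ε := by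
  obtain ⟨hq1, hq2⟩ := abs_lt.mp (hq m)
  obtain ⟨hr1, hr2⟩ := abs_lt.mp (hr m)
  obtain ⟨hf1, hf2⟩ := hf
  have h : stepPos q r ε m x f b
      = x + (ε * move b) • ((q m - r m, q m + r m - 2 * f) : ℝ × ℝ) := by
    rw [Prod.smul_mk]; rfl
  rw [h]
  refine (norm_add_le _ _).trans ?_
  rw [norm_smul, Real.norm_eq_abs, abs_mul, abs_move, mul_one, abs_of_nonneg hε, mul_comm 4]
  gcongr
  rw [norm_prod_le_iff, abs_le, abs_le]
  refine ⟨⟨?_, ?_⟩, ?_, ?_⟩ <;> linarith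

/-- A payoff with a linear lower bound has game values with linear lower bounds. -/
lemma exists_le_gameValue (hq : ∀ m, |q m| < 1) (hr : ∀ m, |r m| < 1) (hε : 0 ≤ ε) {a L : ℝ}
    (hL : 0 ≤ L) (hφ : ∀ x, a - L * ‖x‖ ≤ φ x) (n : ℕ) :
    ∃ a', ∀ m x, a' - L * ‖x‖ ≤ gameValue q r ε φ n m x := by
  induction n with
  | zero => exact ⟨a, fun _ x => hφ x⟩
  | succ n ih =>
    obtain ⟨a', ha'⟩ := ih
    refine ⟨a' - L * (4 * ε), fun m x => ?_⟩
    have : Nonempty (Set.Icc (-1 : ℝ) 1) := ⟨⟨0, by norm_num⟩⟩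
    refine le_ciInf fun f => le_max_of_le_left ((ha' _ _).trans' ?_)
    have := mul_le_mul_of_nonneg_left (norm_stepPos_le hq hr hε m x f.2 true) hL
    linarith

/-- Testing the infimum with one `f` requires the values to be bounded below; the linear lower bound
of the payoff, inherited by the game values, ensures this. -/
lemma gameValue_succ_le (hq : ∀ m, |q m| < 1) (hr : ∀ m, |r m| < 1) (hε : 0 ≤ ε) {a L : ℝ}
    (hL : 0 ≤ L) (hφ : ∀ x, a - L * ‖x‖ ≤ φ x) (n : ℕ) (m : State d) (x : ℝ × ℝ) {f y : ℝ}
    (hf : f ∈ Set.Icc (-1 : ℝ) 1)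
    (h : ∀ b, gameValue q r ε φ n (next m b) (stepPos q r ε m x f b) ≤ y) :
    gameValue q r ε φ (n + 1) m x ≤ y := by
  obtain ⟨a', ha'⟩ := exists_le_gameValue hq hr hε hL hφ n
  refine (ciInf_le ⟨a' - L * (‖x‖ + 4 * ε), ?_⟩ (⟨f, hf⟩ : Set.Icc (-1 : ℝ) 1)).trans
    (max_le (h true) (h false))
  rintro _ ⟨g, rfl⟩
  refine le_max_of_le_left ((ha' _ _).trans' ?_)
  have := mul_le_mul_of_nonneg_left (norm_stepPos_le hq hr hε m x g.2 true) hL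
  linarith

lemma exists_uniform_gap (hq : ∀ m, |q m| < 1) (hr : ∀ m, |r m| < 1) :
    ∃ δ > 0, ∀ m, |q m| ≤ 1 - δ ∧ |r m| ≤ 1 - δ := by
  obtain ⟨m₀, h⟩ := Finite.exists_max fun m => max |q m| |r m|
  refine ⟨1 - max |q m₀| |r m₀|, sub_pos.mpr (max_lt (hq m₀) (hr m₀)), fun m => ?_⟩
  rw [sub_sub_cancel]
  exact max_le_iff.mp (h m)

/-! ### Error constants, one step of the game, and the induction over the steps. -/

/-- The coefficient of `ε ^ 3` in the error of the increment of `u` in space. -/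
noncomputable def spaceError (K c D : ℝ) : ℝ :=
  K * (D * K / c) * (2 + D * K / c) + K * (2 + D * K / c) ^ 3

/-- The coefficient of `ε ^ 3` in the error of a single step of the game. -/
noncomputable def stepError (K c D : ℝ) : ℝ :=
  spaceError K c D + K * (2 + D * K / c) + K + D * (K * (2 + D * K / c) + K)

/-- The coefficient of `ε ^ 2` in the error of the last step of the game. -/
noncomputable def finalError (K c D : ℝ) : ℝ :=
  3 * D * K + K + spaceError K c D

variable {K c T₀ T C D δ : ℝ} {u : ℝ → ℝ × ℝ → ℝ} {κ B : State d → ℝ}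

/-- The hypotheses on the solution `u`, together with the potential `κ`, that control one step of
the game. -/
structure Controlled (q r : State d → ℝ) (κ B : State d → ℝ) (K c T₀ T C D δ : ℝ)
    (φ : ℝ × ℝ → ℝ) (u : ℝ → ℝ × ℝ → ℝ) : Prop where
  c_pos : 0 < c
  C_pos : 0 < C
  δ_pos : 0 < δ
  q_lt : ∀ m, |q m| < 1
  r_lt : ∀ m, |r m| < 1
  gap : ∀ m, |q m| ≤ 1 - δ ∧ |r m| ≤ 1 - δ
  κ_le : ∀ m, |κ m| ≤ D
  B_le : ∀ m, |B m| ≤ D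
  sq_le : ∀ m, (q m - r m) ^ 2 / C ≤ D
  potential : ∀ m b, (q m - r m) ^ 2 / C - 1 - move b * B m + κ (next m b) - κ m ≤ 0
  solves : SolvesPDE C T₀ T φ u
  smooth : SmoothBounded K T₀ T u
  deta_gt : ∀ t ∈ Set.Ioo T₀ T, ∀ x, c < deta u t x
  dxi_le : ∀ t ∈ Set.Ioo T₀ T, ∀ x, |dxi u t x| ≤ deta u t x
  dt_nonpos : ∀ t ∈ Set.Ioo T₀ T, ∀ x, dt u t x ≤ 0

namespace Controlled

lemma D_nonneg (h : Controlled q r κ B K c T₀ T C D δ φ u) : 0 ≤ D :=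
  (abs_nonneg _).trans (h.κ_le fun _ => true)

/-- The derivative bounds hold only before `T`, so the spatial Lipschitz bound is taken at an
interior time and carried to `T` by the Lipschitz bound in time. -/
lemma exists_payoff_ge (h : Controlled q r κ B K c T₀ T C D δ φ u) (hT : T₀ < T) :
    ∃ a, ∀ x, a - K * ‖x‖ ≤ φ x := by
  obtain ⟨s, hs⟩ := exists_between hT
  refine ⟨u s 0 - K * (T - s), fun x => ?_⟩
  have h1 := (abs_le.mp (h.smooth.abs_sub_le hs 0 x)).1
  have h2 := (abs_le.mp (h.smooth.abs_sub_time_le h.solves.continuous hs.1 hs.2 le_rfl x)).1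
  rw [h.solves.final] at h2
  rw [sub_zero] at h1
  linarith

lemma exists_investment (h : Controlled q r κ B K c T₀ T C D δ φ u) {t : ℝ}
    (ht : t ∈ Set.Ioo T₀ T) (hε : 0 < ε) (hε1 : ε ≤ 1) (hεδ : ε * (D * K / c) ≤ 2 * δ)
    (m : State d) (x : ℝ × ℝ) :
    ∃ f ∈ Set.Icc (-1 : ℝ) 1, ∀ b, ‖stepPos q r ε m x f b - x‖ ≤ ε * (2 + D * K / c) ∧
      u t (stepPos q r ε m x f b) ≤ u t x
        + ε ^ 2 * (move b * B m * dt u t x - (q m - r m) ^ 2 / C * dt u t x)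
        + spaceError K c D * ε ^ 3 := by
  have hpde := h.solves.equation t ht x
  have hη : 0 < deta u t x := h.c_pos.trans (h.deta_gt t ht x)
  rw [hess, perpDir, neg_div, div_self hη.ne'] at hpde
  obtain ⟨f, hf, hf'⟩ := StockPrediction.exists_investment (B := B m) (q := q m) (r := r m)
    ((h.smooth.contDiff_u t ht).of_le (by norm_num))
    (h.smooth.bound_u 2 (by norm_num) (by norm_num) t ht)
    (h.smooth.bound_u 3 (by norm_num) (by norm_num) t ht) h.c_pos h.C_pos x (h.deta_gt t ht x)
    (h.dxi_le t ht x) (h.smooth.abs_dt_le ht x) (h.B_le m) hpde h.δ_pos.le (h.gap m).1 (h.gap m).2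
    hε hε1 hεδ
  refine ⟨f, hf, fun b => ?_⟩
  have hs : stepPos q r ε m x f b
      = x + (ε * move b * (q m - r m), ε * move b * (q m + r m - 2 * f)) := rfl
  rw [hs, add_sub_cancel_left]
  exact hf' (move b) (abs_move b)

/-- Nothing is assumed on `u_t` at time `T`, so the corrector is not available there. All terms of
order `ε ^ 2` are bounded crudely, which is affordable once. -/
lemma gameValue_one_le (h : Controlled q r κ B K c T₀ T C D δ φ u) (hε : 0 < ε) (hε1 : ε ≤ 1)
    (hεδ : ε * (D * K / c) ≤ 2 * δ) (ht : T₀ < T - ε ^ 2) (m : State d) (x : ℝ × ℝ) :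
    gameValue q r ε φ 1 m x ≤ u (T - ε ^ 2) x - ε ^ 2 * (κ m * dt u (T - ε ^ 2) x)
      + finalError K c D * ε ^ 2 := by
  have hε2 : 0 < ε ^ 2 := by positivity
  have htm : T - ε ^ 2 ∈ Set.Ioo T₀ T := ⟨ht, by linarith⟩
  have hK := h.smooth.nonneg htm
  have hD := h.D_nonneg
  obtain ⟨a, ha⟩ := h.exists_payoff_ge (ht.trans htm.2)
  obtain ⟨f, hf, hf'⟩ := h.exists_investment htm hε hε1 hεδ m x
  refine gameValue_succ_le h.q_lt h.r_lt hε.le hK ha 0 m x hf fun b => ?_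
  obtain ⟨-, hb⟩ := hf' b
  have h1 := (abs_le.mp (h.smooth.abs_sub_time_le h.solves.continuous ht htm.2 le_rfl
    (stepPos q r ε m x f b))).2
  rw [h.solves.final, sub_sub_cancel] at h1
  have hdt := h.smooth.abs_dt_le htm x
  have hprod {y : ℝ} (hy : |y| ≤ D) : |y * dt u (T - ε ^ 2) x| ≤ D * K := by
    rw [abs_mul]; gcongr
  have h2 := (abs_le.mp (hprod (h.κ_le m))).2
  have h3 := (abs_le.mp (hprod (y := move b * B m)
    (by rw [abs_mul, abs_move, one_mul]; exact h.B_le m))).2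
  have h4 := (abs_le.mp (hprod (y := (q m - r m) ^ 2 / C)
    (by rw [abs_of_nonneg (div_nonneg (sq_nonneg _) h.C_pos.le)]; exact h.sq_le m))).1
  have h5 := mul_le_mul_of_nonneg_left
    (show move b * B m * dt u (T - ε ^ 2) x - (q m - r m) ^ 2 / C * dt u (T - ε ^ 2) x
      + κ m * dt u (T - ε ^ 2) x ≤ 3 * D * K by linarith) hε2.le
  have hS : 0 ≤ spaceError K c D := by
    have := h.c_pos
    unfold spaceError; positivity
  have h6 : spaceError K c D * ε ^ 3 ≤ spaceError K c D * ε ^ 2 :=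
    mul_le_mul_of_nonneg_left (pow_le_pow_of_le_one hε.le hε1 (by norm_num)) hS
  change φ (stepPos q r ε m x f b) ≤ _
  unfold finalError
  linarith

/-- One step of the game, for the corrected solution `u - ε² κ u_t`. -/
lemma exists_step_le (h : Controlled q r κ B K c T₀ T C D δ φ u) (hε : 0 < ε) (hε1 : ε ≤ 1)
    (hεδ : ε * (D * K / c) ≤ 2 * δ) {t : ℝ} (ht : T₀ < t) (ht' : t + ε ^ 2 < T) (m : State d)
    (x : ℝ × ℝ) :
    ∃ f ∈ Set.Icc (-1 : ℝ) 1, ∀ b,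
      u (t + ε ^ 2) (stepPos q r ε m x f b)
        - ε ^ 2 * (κ (next m b) * dt u (t + ε ^ 2) (stepPos q r ε m x f b)) ≤
      u t x - ε ^ 2 * (κ m * dt u t x) + stepError K c D * ε ^ 3 := by
  have hε2 : 0 < ε ^ 2 := by positivity
  have htm : t ∈ Set.Ioo T₀ T := ⟨ht, by linarith⟩
  have hK := h.smooth.nonneg htm
  have hD := h.D_nonneg
  have hc := h.c_pos
  obtain ⟨f, hf, hf'⟩ := h.exists_investment htm hε hε1 hεδ m x
  refine ⟨f, hf, fun b => ?_⟩
  obtain ⟨hn, hb⟩ := hf' b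
  set y := stepPos q r ε m x f b
  set R := 2 + D * K / c with hR
  have h1 := h.smooth.le_add_dt h.solves.continuous ht (show t < t + ε ^ 2 by linarith) ht'.le y
  have h2 := h.smooth.abs_dt_sub_time_le ht (show t < t + ε ^ 2 by linarith) ht' y
  rw [add_sub_cancel_left] at h1 h2
  have h3 : |dt u t y - dt u t x| ≤ K * R * ε := by
    refine (h.smooth.abs_dt_sub_le htm x y).trans ?_
    calc K * ‖y - x‖ ≤ K * (ε * R) := by gcongr
      _ = K * R * ε := by ring
  have hεε : ε ^ 2 ≤ ε := by nlinarith
  have h4 : |dt u (t + ε ^ 2) y - dt u t x| ≤ (K * R + K) * ε := by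
    have := abs_sub_le (dt u (t + ε ^ 2) y) (dt u t y) (dt u t x)
    nlinarith
  -- Freezes `u_t` at the old time and position inside the new corrector, so that the terms of order
  -- `ε ^ 2` share the factor `dt u t x`.
  have h5 : |κ (next m b) * (dt u (t + ε ^ 2) y - dt u t x)| ≤ D * ((K * R + K) * ε) := by
    rw [abs_mul]
    have := h.κ_le (next m b)
    gcongr
  have h6 := mul_le_mul_of_nonneg_left (abs_le.mp h5).1 hε2.le
  have h7 := mul_le_mul_of_nonneg_left (abs_le.mp h3).2 hε2.le
  have h8 : K * (ε ^ 2) ^ 2 ≤ K * ε ^ 3 := by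
    rw [← pow_mul]
    exact mul_le_mul_of_nonneg_left (pow_le_pow_of_le_one hε.le hε1 (by norm_num)) hK
  -- The cancellation at order `ε ^ 2`: the potential inequality and `u_t ≤ 0` have matching signs.
  have h9 := mul_nonneg hε2.le (mul_nonneg_of_nonpos_of_nonpos (h.potential m b)
    (h.dt_nonpos t htm x))
  unfold stepError
  rw [← hR]
  nlinarith

lemma gameValue_le (h : Controlled q r κ B K c T₀ T C D δ φ u) (hε : 0 < ε) (hε1 : ε ≤ 1)
    (hεδ : ε * (D * K / c) ≤ 2 * δ) (n : ℕ) :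
    ∀ t, T₀ < t → t + (n + 1) * ε ^ 2 = T → ∀ m x,
      gameValue q r ε φ (n + 1) m x ≤ u t x - ε ^ 2 * (κ m * dt u t x)
        + finalError K c D * ε ^ 2 + n * (stepError K c D * ε ^ 3) := by
  have hε2 : 0 < ε ^ 2 := by positivity
  induction n with
  | zero =>
    intro t ht htT m x
    obtain rfl : t = T - ε ^ 2 := by
      push_cast at htT
      linarith
    simpa using h.gameValue_one_le hε hε1 hεδ ht m x
  | succ n ih =>
    intro t ht htT m x
    push_cast at htT
    have ht' : t + ε ^ 2 < T := by
      have : (0 : ℝ) ≤ n * ε ^ 2 := by positivity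
      linarith
    have hK := h.smooth.nonneg (t := t) ⟨ht, by linarith⟩
    obtain ⟨a, ha⟩ := h.exists_payoff_ge (show T₀ < T by linarith)
    obtain ⟨f, hf, hf'⟩ := h.exists_step_le hε hε1 hεδ ht ht' m x
    refine gameValue_succ_le h.q_lt h.r_lt hε.le hK ha (n + 1) m x hf fun b => ?_
    have h1 := ih (t + ε ^ 2) (by linarith) (by linarith) (next m b) (stepPos q r ε m x f b)
    have h2 := hf' b
    push_cast
    linarith

end Controlled

end Game

end StockPrediction

/-! ### Choice of the constants and conclusion. -/

theorem mainTheorem1 (d : ℕ) (hd : 1 ≤ d) (K c : ℝ) (hc : 0 < c) :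
    ∃ C : ℝ, ∀ (q r : StockPrediction.State d → ℝ),
      (∀ m, |q m| < 1) → (∀ m, |r m| < 1) → (∃ m, q m ≠ r m) →
      ∃ ε₀ : ℝ, 0 < ε₀ ∧
        ∀ (T₀ T : ℝ) (φ : ℝ × ℝ → ℝ) (u : ℝ → ℝ × ℝ → ℝ),
          StockPrediction.SolvesPDE (StockPrediction.investorLPValue q r) T₀ T φ u →
          StockPrediction.SmoothBounded K T₀ T u →
          (∀ t ∈ Set.Ioo T₀ T, ∀ x, c < StockPrediction.deta u t x) →
          (∀ t ∈ Set.Ioo T₀ T, ∀ x,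
            |StockPrediction.dxi u t x| ≤ StockPrediction.deta u t x) →
          (∀ t ∈ Set.Ioo T₀ T, ∀ x, StockPrediction.dt u t x ≤ 0) →
          ∀ ε : ℝ, 0 < ε → ε ≤ ε₀ →
            ∀ t : ℝ, T₀ < t → t < T → (∃ N : ℕ, (T - t) / ε ^ 2 = N) →
              ∀ (m : StockPrediction.State d) (ξ η : ℝ),
                StockPrediction.scaledValue q r φ T ε t m (ξ, η)
                  ≤ u t (ξ, η) + C * ((T - t) + ε) * ε := by
  open StockPrediction in
  set D : ℝ := d * 2 ^ d
  have hD : 0 ≤ D := by positivity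
  -- The three terms pay for removing the corrector at time `t`, for the last step and for all the
  -- earlier steps.
  refine ⟨D * K + finalError K c D + stepError K c D, fun q r hq hr hqr => ?_⟩
  obtain ⟨κ, B, hκ, hB, hsq, hpot⟩ := exists_potential hd hqr
  obtain ⟨δ, hδ, hgap⟩ := exists_uniform_gap hq hr
  have hden : 0 < D * |K| / c + 1 := by positivity
  -- At this point `K` may still be negative, hence `|K|`; the `+ 1` keeps the denominator positive
  -- when `K = 0`.
  refine ⟨min 1 (2 * δ / (D * |K| / c + 1)), by positivity, ?_⟩
  intro T₀ T φ u hpde hsmooth hη hξ hut ε hε hεε₀ t ht htT hN m ξ η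
  obtain ⟨N, hN⟩ := hN
  have hctrl : Controlled q r κ B K c T₀ T (investorLPValue q r) D δ φ u :=
    ⟨hc, investorLPValue_pos hd hqr, hδ, hq, hr, hgap, hκ, hB, hsq, hpot, hpde, hsmooth, hη, hξ,
      hut⟩
  have hK := hsmooth.nonneg (t := t) ⟨ht, htT⟩
  have hεδ : ε * (D * K / c) ≤ 2 * δ := by
    have := (le_div_iff₀ hden).mp (hεε₀.trans (min_le_right _ _))
    rw [abs_of_nonneg hK] at this
    linarith
  have hε2 : 0 < ε ^ 2 := by positivity
  have hNT : T - t = N * ε ^ 2 := (div_eq_iff hε2.ne').mp hN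
  obtain ⟨n, rfl⟩ : ∃ n, N = n + 1 := by
    refine Nat.exists_eq_succ_of_ne_zero ?_
    rintro rfl
    simp only [Nat.cast_zero, zero_mul] at hNT
    linarith
  have hmain := hctrl.gameValue_le hε (hεε₀.trans (min_le_left _ _)) hεδ n t ht
    (by push_cast at hNT; linarith) m (ξ, η)
  rw [scaledValue, hN, Nat.floor_natCast]
  have hκt : |κ m * dt u t (ξ, η)| ≤ D * K := by
    rw [abs_mul]
    have := hκ m
    have := hsmooth.abs_dt_le ⟨ht, htT⟩ (ξ, η)
    gcongr
  have h1 := mul_le_mul_of_nonneg_left (abs_le.mp hκt).1 hε2.le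
  have hS : 0 ≤ spaceError K c D := by unfold spaceError; positivity
  have hE : 0 ≤ stepError K c D := by unfold stepError; positivity
  have hF : 0 ≤ finalError K c D := by unfold finalError; positivity
  have hTt : 0 ≤ T - t := by linarith
  have h2 : n * (stepError K c D * ε ^ 3) ≤ stepError K c D * (T - t) * ε := by
    have : n * (stepError K c D * ε ^ 3) + stepError K c D * ε ^ 3
        = stepError K c D * (T - t) * ε := by rw [hNT]; push_cast; ring
    have : 0 ≤ stepError K c D * ε ^ 3 := by positivity
    linarith
  have h3 : 0 ≤ (D * K + finalError K c D) * (T - t) * ε := by positivity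
  have h4 : 0 ≤ stepError K c D * ε ^ 2 := by positivity
  linarith
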